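/- **Vanishing Theorem.** Let $G$ be a finite graph (loops and multiple edges allowed), with a fixed linear ordering of its edge set $E$. Let $\mathcal A=\bigoplus_{j\ge 0}A_j$ be a commutative graded $\mathbb Z$-algebra with identity such that every $A_j$ is a free $\mathbb Z$-module of finite rank. For $s\subseteq E$ let $[G:s]$ be the graph with the vertices of $G$ and edge set $s$, and let $C^s(G)$ be the tensor product over $\mathbb Z$ of copies of $\mathcal A$, one for each connected component of $[G:s]$. Put $C^i(G)=\bigoplus_{|s|=i}C^s(G)$. For $e\in E\setminus s$ the per-edge map $C^s(G)\to C^{s\cup\{e\}}(G)$ is the identity if $e$ joins a component of $[G:s]$ to itself; if $e$ joins two different components, it is the multiplication $\mathcal A\otimes\mathcal A\to\mathcal A$ on the two corresponding factors and the identity on the other factors. The differential $d^i:C^i(G)\to C^{i+1}(G)$ is the sum of all per-edge maps with $|s|=i$, each taken with the sign $(-1)^{\#\{e'\in s\,:\,e'<e\}}$. Let $H^i_{\mathcal A}(G)=\ker d^i/\operatorname{im} d^{i-1}$ for $i\in\mathbb Z$ (with $C^i(G)=0$ unless $0\le i\le |E|$). Write $G=G_1\sqcup G_2$, where $G_2$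 is the union of the connected components of $G$ that are trees (an isolated vertex is a tree) and $G_1$ is the union of the remaining components. Let $v_1$ be the number of vertices and $\mu_1$ the number of connected components of $G_1$. Then for every $i\in\mathbb Z$: (a) if $H^i_{\mathcal A}(G)\neq 0$, then $0\le i\le v_1-2\mu_1$; (b) if the torsion subgroup of $H^i_{\mathcal A}(G)$ is nonzero, then $1\le i\le v_1-2\mu_1$. -/

import Mathlib

open scoped TensorProduct Graph

namespace GraphCohomology

universe u v w

/-! ### Finite multigraphs: components, cycles, trees -/

/-- The set of connected components of a graph: the quotient of the vertex set by the equivalence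
relation generated by adjacency. -/
def Component {α : Type u} {β : Type v} (H : Graph α β) : Type u :=
  Quot (fun x y : V(H) => H.Adj x y)

/-- The component containing a given vertex. -/
def Component.of {α : Type u} {β : Type v} (H : Graph α β) (x : V(H)) : Component H :=
  Quot.mk _ x

instance {α : Type u} {β : Type v} (H : Graph α β) [Finite V(H)] : Finite (Component H) :=
  inferInstanceAs (Finite (Quot _))

instance {α : Type u} {β : Type v} (H : Graph α β) (s : Set β) [h : Finite V(H)] :
    Finite V(H.restrict s) := h

/-- For a subgraph `H` of `K`, the map sending a component of `H` to the component of `K`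
that contains it. -/
def Component.map {α : Type u} {β : Type v} {H K : Graph α β} (h : H ≤ K) :
    Component H → Component K :=
  Quot.map (fun x => ⟨x.1, h.vertexSet_mono x.2⟩) (fun _ _ hxy => hxy.mono h)

theorem Component.map_comp {α : Type u} {β : Type v} {H K L : Graph α β} (h : H ≤ K) (h' : K ≤ L) :
    Component.map h' ∘ Component.map h = Component.map (h.trans h') := by
  funext c
  induction c using Quot.ind
  rfl

/-- A graph is acyclic if it has no cycle, a cycle of length `n + 1` consisting of distinct vertices
`x₀, …, xₙ` and distinct edges `e₀, …, eₙ` such that `eₖ` joins `xₖ` to `xₖ₊₁` (indices modulo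
`n + 1`). A loop is a cycle of length one and a pair of parallel edges is a cycle of length two. -/
def IsAcyclic {α : Type u} {β : Type v} (H : Graph α β) : Prop :=
  ∀ (n : ℕ) (x : Fin (n + 1) → α) (e : Fin (n + 1) → β),
    Function.Injective x → Function.Injective e → ¬ ∀ k, H.IsLink (e k) (x k) (x (k + 1))

/-- A tree is a connected (in particular nonempty) graph without cycles. -/
def IsTree {α : Type u} {β : Type v} (H : Graph α β) : Prop :=
  Nat.card (Component H) = 1 ∧ IsAcyclic H

/-- A connected component, as a graph. -/
def componentGraph {α : Type u} {β : Type v} (G : Graph α β) (c : Component G) : Graph α β :=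
  G.induce {x | ∃ hx : x ∈ V(G), Component.of G ⟨x, hx⟩ = c}

/-- The union of the components of `G` that are not trees. -/
def nonTreePart {α : Type u} {β : Type v} (G : Graph α β) : Graph α β :=
  G.induce {x | ∃ hx : x ∈ V(G), ¬ IsTree (componentGraph G (Component.of G ⟨x, hx⟩))}

/-! ### Multiplication maps between tensor powers of a commutative ring -/

/-- For a map `f : ι → κ` of index sets, the map `A^{⊗ι} → A^{⊗κ}` which multiplies together the
factors whose indices have the same image:
`⊗ᵢ aᵢ ↦ ⊗ₖ (∏_{f i = k} aᵢ)`. If `f` is a bijection, this is the identification of the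
two tensor powers; if `f` merges exactly two indices (and is surjective), it is the multiplication
`A ⊗ A → A` on these two factors and the identity on the others. -/
noncomputable def mulMap (A : Type w) [CommRing A] {ι κ : Type u} [Finite ι] (f : ι → κ) :
    (⨂[ℤ] _ : ι, A) →ₗ[ℤ] ⨂[ℤ] _ : κ, A :=
  letI := Fintype.ofFinite ι
  letI := Classical.decEq κ
  PiTensorProduct.lift
    { toFun := fun a => PiTensorProduct.tprod ℤ (fun k => ∏ i with f i = k, a i)
      map_update_add' := by
        intro _ a i x y
        have key : ∀ z : A, (fun k => ∏ j with f j = k, Function.update a i z j) =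
            Function.update (fun k => ∏ j with f j = k, a j) (f i)
              (z * ∏ j ∈ Finset.univ.filter (fun j => f j = f i) \ {i}, a j) := by
          intro z
          funext k
          by_cases hk : k = f i
          · subst hk
            rw [Function.update_self, Finset.prod_update_of_mem (by simp)]
          · rw [Function.update_of_ne hk, Finset.prod_update_of_notMem]
            simpa using Ne.symm hk
        rw [key, key, key, add_mul, MultilinearMap.map_update_add]
      map_update_smul' := by
        intro _ a i r x
        have key : ∀ z : A, (fun k => ∏ j with f j = k, Function.update a i z j) =
            Function.update (fun k => ∏ j with f j = k, a j) (f i)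
              (z * ∏ j ∈ Finset.univ.filter (fun j => f j = f i) \ {i}, a j) := by
          intro z
          funext k
          by_cases hk : k = f i
          · subst hk
            rw [Function.update_self, Finset.prod_update_of_mem (by simp)]
          · rw [Function.update_of_ne hk, Finset.prod_update_of_notMem]
            simpa using Ne.symm hk
        rw [key, key, smul_mul_assoc, MultilinearMap.map_update_smul] }

theorem mulMap_tprod (A : Type w) [CommRing A] {ι κ : Type u} [Fintype ι] [DecidableEq κ]
    (f : ι → κ) (a : ι → A) :
    mulMap A f (PiTensorProduct.tprod ℤ a) =
      PiTensorProduct.tprod ℤ (fun k => ∏ i with f i = k, a i) := by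
  rw [mulMap]
  erw [PiTensorProduct.lift.tprod]
  simp only [MultilinearMap.coe_mk]
  congr!

theorem mulMap_id (A : Type w) [CommRing A] {ι : Type u} [Finite ι] :
    mulMap A (id : ι → ι) = LinearMap.id := by
  classical
  have := Fintype.ofFinite ι
  ext a
  simp only [LinearMap.compMultilinearMap_apply, mulMap_tprod, LinearMap.id_apply]
  congr 1
  funext k
  rw [Finset.prod_eq_single k (by simp) (by simp)]

theorem mulMap_mulMap (A : Type w) [CommRing A] {ι κ μ : Type u} [Finite ι] [Finite κ]
    (f : ι → κ) (g : κ → μ) (x : ⨂[ℤ] _ : ι, A) :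
    mulMap A g (mulMap A f x) = mulMap A (g ∘ f) x := by
  classical
  have := Fintype.ofFinite ι
  have := Fintype.ofFinite κ
  suffices h : mulMap A g ∘ₗ mulMap A f = mulMap A (g ∘ f) from LinearMap.congr_fun h x
  ext a
  simp only [LinearMap.compMultilinearMap_apply, LinearMap.comp_apply, mulMap_tprod]
  congr 1
  funext m
  rw [← Finset.prod_fiberwise_of_maps_to (s := Finset.univ.filter fun i => (g ∘ f) i = m)
    (t := Finset.univ.filter fun k => g k = m) (g := f) (by simp)]
  refine Finset.prod_congr rfl fun k hk => Finset.prod_congr ?_ fun _ _ => rfl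
  ext i
  simp only [Finset.mem_filter, Finset.mem_univ, true_and, Function.comp] at hk ⊢
  exact ⟨fun h => ⟨h ▸ hk, h⟩, fun h => h.2⟩

/-! ### The cochain complex -/

/-- The sets of edges of `G` with exactly `i` elements, i.e. the vertices of height `i` of the cube
`{0, 1}^{E(G)}`. There are none when `i < 0` or `i > |E(G)|`. -/
structure State {α : Type u} {β : Type v} (G : Graph α β) (i : ℤ) : Type v where
  /-- the set of edges -/
  edges : Finset β
  subset : (edges : Set β) ⊆ E(G)
  card_edges : (edges.card : ℤ) = i

/-- Removing an edge from a set of edges. -/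
def State.erase {α : Type u} {β : Type v} [LinearOrder β] {G : Graph α β} {i j : ℤ}
    (h : i + 1 = j) (t : State G j) (e : t.edges) : State G i :=
  ⟨t.edges.erase e, fun _ hx => t.subset (Finset.mem_of_mem_erase hx), by
    have h1 := Finset.card_erase_add_one e.2
    have h2 := t.card_edges
    omega⟩

theorem State.erase_subset {α : Type u} {β : Type v} [LinearOrder β] {G : Graph α β} {i j : ℤ}
    (h : i + 1 = j) (t : State G j) (e : t.edges) : (t.erase h e).edges ⊆ t.edges :=
  Finset.erase_subset _ _

/-- The module attached to a set `s` of edges of `G`: the tensor product of copies of `A`,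
one for each component of the spanning subgraph `[G : s]` with edge set `s`. -/
abbrev StateModule (A : Type w) [CommRing A] {α : Type u} {β : Type v} (G : Graph α β)
    (s : Finset β) : Type (max u w) :=
  ⨂[ℤ] _ : Component (G.restrict (s : Set β)), A

/-- The cochain group `Cⁱ(G) = ⨁_{|s| = i} C^s(G)`; the direct sum is written as a product, which is
the same thing because a finite graph has only finitely many sets of edges. -/
abbrev Cochain (A : Type w) [CommRing A] {α : Type u} {β : Type v} (G : Graph α β) (i : ℤ) :
    Type (max u v w) :=
  ∀ s : State G i, StateModule A G s.edges

/-- The per-edge map `C^s(G) → C^t(G)`, used for `t = s ∪ {e}`: if `e` joins a component of `[G : s]`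
to itself it is the identity, and if `e` joins two different components it multiplies the two
corresponding tensor factors and is the identity on the others. -/
noncomputable def perEdgeMap (A : Type w) [CommRing A] {α : Type u} {β : Type v} (G : Graph α β)
    [Finite V(G)] {s t : Finset β} (h : s ⊆ t) : StateModule A G s →ₗ[ℤ] StateModule A G t :=
  mulMap A (Component.map (G.restrict_mono_right (Finset.coe_subset.2 h)))

/-- The differential `dⁱ : Cⁱ(G) → Cʲ(G)`, `j = i + 1`: the component at `t` is the sum over
the edges `e ∈ t` of the per-edge maps from `s = t \ {e}`, with sign `-1` if the number of elements of
`s` that precede `e` is odd and `1` if it is even. -/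
noncomputable def d (A : Type w) [CommRing A] {α : Type u} {β : Type v} [LinearOrder β]
    (G : Graph α β) [Finite V(G)] (i j : ℤ) (h : i + 1 = j) : Cochain A G i →ₗ[ℤ] Cochain A G j :=
  LinearMap.pi fun t => ∑ e : t.edges,
    ((-1 : ℤ) ^ ((t.edges.erase e.1).filter (fun e' => e' < e.1)).card) •
      (perEdgeMap A G (t.erase_subset h e) ∘ₗ LinearMap.proj (t.erase h e))

theorem d_apply (A : Type w) [CommRing A] {α : Type u} {β : Type v} [LinearOrder β]
    (G : Graph α β) [Finite V(G)] (i j : ℤ) (h : i + 1 = j) (x : Cochain A G i) (t : State G j) :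
    d A G i j h x t = ∑ e : t.edges,
      ((-1 : ℤ) ^ ((t.edges.erase e.1).filter (fun e' => e' < e.1)).card) •
        perEdgeMap A G (t.erase_subset h e) (x (t.erase h e)) := by
  simp only [d, LinearMap.pi_apply, LinearMap.sum_apply, LinearMap.smul_apply,
    LinearMap.comp_apply, LinearMap.proj_apply]

theorem perEdgeMap_perEdgeMap (A : Type w) [CommRing A] {α : Type u} {β : Type v} (G : Graph α β)
    [Finite V(G)] {s t r : Finset β} (h : s ⊆ t) (h' : t ⊆ r) (x : StateModule A G s) :
    perEdgeMap A G h' (perEdgeMap A G h x) = perEdgeMap A G (h.trans h') x := by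
  rw [perEdgeMap, perEdgeMap, mulMap_mulMap, Component.map_comp]
  rfl

/-- The signs of the two ways round a square of the cube are opposite. -/
theorem sign_swap {β : Type v} [LinearOrder β] (r : Finset β) {e f : β} (he : e ∈ r) (hf : f ∈ r)
    (hef : e ≠ f) :
    ((-1 : ℤ) ^ ((r.erase e).filter (fun e' => e' < e)).card) *
        (-1) ^ (((r.erase e).erase f).filter (fun e' => e' < f)).card =
      -(((-1 : ℤ) ^ ((r.erase f).filter (fun e' => e' < f)).card) *
        (-1) ^ (((r.erase f).erase e).filter (fun e' => e' < e)).card) := by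
  wlog hlt : e < f generalizing e f
  · rw [this hf he hef.symm (lt_of_le_of_ne (not_lt.1 hlt) hef.symm), neg_neg]
  have h1 : ((r.erase f).erase e).filter (fun e' => e' < e) =
      (r.erase e).filter (fun e' => e' < e) := by
    ext a
    simp only [Finset.mem_filter, Finset.mem_erase]
    exact ⟨fun h => ⟨⟨h.1.1, h.1.2.2⟩, h.2⟩, fun h => ⟨⟨h.1.1, (h.2.trans hlt).ne, h.1.2⟩, h.2⟩⟩
  have h2 : ((r.erase e).erase f).filter (fun e' => e' < f) =
      ((r.erase f).filter (fun e' => e' < f)).erase e := by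
    ext a
    simp only [Finset.mem_filter, Finset.mem_erase]
    tauto
  have h3 := Finset.card_erase_add_one
    (show e ∈ (r.erase f).filter (fun e' => e' < f) by simp [hef, he, hlt])
  rw [h1, h2, ← h3, pow_succ]
  ring

theorem d_d (A : Type w) [CommRing A] {α : Type u} {β : Type v} [LinearOrder β]
    (G : Graph α β) [Finite V(G)] (i j k : ℤ) (h : i + 1 = j) (h' : j + 1 = k) :
    d A G j k h' ∘ₗ d A G i j h = 0 := by
  classical
  refine LinearMap.ext fun x => funext fun r => ?_
  let y : Finset β → StateModule A G r.edges := fun s =>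
    if hs : s ⊆ r.edges ∧ ((s : Set β) ⊆ E(G) ∧ (s.card : ℤ) = i) then
      perEdgeMap A G hs.1 (x ⟨s, hs.2.1, hs.2.2⟩) else 0
  let F : β → β → StateModule A G r.edges := fun e f =>
    (((-1 : ℤ) ^ ((r.edges.erase e).filter (fun e' => e' < e)).card) *
        (-1) ^ (((r.edges.erase e).erase f).filter (fun e' => e' < f)).card) •
      y ((r.edges.erase e).erase f)
  have hF : d A G j k h' (d A G i j h x) r =
      ∑ e ∈ r.edges, ∑ f ∈ r.edges, if e = f then 0 else F e f := by
    rw [d_apply, Finset.sum_coe_sort r.edges (fun e => ∑ f ∈ r.edges, if e = f then 0 else F e f) |>.symm]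
    refine Finset.sum_congr rfl fun e _ => ?_
    rw [d_apply, map_sum, Finset.smul_sum]
    have : ∑ f ∈ r.edges, (if (e : β) = f then 0 else F e f) = ∑ f ∈ r.edges.erase e, F e f := by
      rw [← Finset.add_sum_erase _ _ e.2, if_pos rfl, zero_add]
      refine Finset.sum_congr rfl fun f hf => if_neg (Finset.ne_of_mem_erase hf).symm
    rw [this]
    refine Eq.trans ?_ (Finset.sum_coe_sort (r.edges.erase e) (fun f => F e f))
    refine Finset.sum_congr rfl fun f _ => ?_
    have hs : (r.edges.erase e).erase f ⊆ r.edges ∧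
        ((((r.edges.erase e).erase f : Finset β) : Set β) ⊆ E(G) ∧
          (((r.edges.erase e).erase f).card : ℤ) = i) :=
      ⟨(Finset.erase_subset _ _).trans (Finset.erase_subset _ _),
        (State.erase h (State.erase h' r e) f).subset,
        (State.erase h (State.erase h' r e) f).card_edges⟩
    simp only [F, y]
    rw [dif_pos hs, map_zsmul, smul_smul]
    congr 1
    exact perEdgeMap_perEdgeMap A G _ _ _
  have hanti : ∀ e ∈ r.edges, ∀ f ∈ r.edges, e ≠ f → F e f = -F f e := by
    intro e he f hf hef
    simp only [F]
    rw [sign_swap r.edges he hf hef, Finset.erase_right_comm, neg_smul]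
  change d A G j k h' (d A G i j h x) r = 0
  rw [hF, ← Finset.sum_product']
  refine Finset.sum_involution (fun p _ => (p.2, p.1)) ?_ ?_ ?_ ?_
  · rintro ⟨e, f⟩ hp
    rw [Finset.mem_product] at hp
    by_cases hef : e = f
    · simp [hef]
    · simp only [if_neg hef, if_neg (Ne.symm hef)]
      rw [hanti e hp.1 f hp.2 hef, neg_add_cancel]
  · rintro ⟨e, f⟩ _ hne heq
    have : f = e := congrArg Prod.fst heq
    exact hne (by simp [this])
  · rintro ⟨e, f⟩ hp
    simpa [and_comm] using hp
  · rintro ⟨e, f⟩ _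
    rfl

/-- The cohomology group `Hⁱ_A(G) = ker dⁱ / im dⁱ⁻¹`, for every integer `i`. -/
abbrev Cohomology (A : Type w) [CommRing A] {α : Type u} {β : Type v} [LinearOrder β]
    (G : Graph α β) [Finite V(G)] (i : ℤ) : Type (max u v w) :=
  LinearMap.ker (d A G i (i + 1) rfl) ⧸
    (LinearMap.range (d A G (i - 1) i (sub_add_cancel i 1))).submoduleOf
      (LinearMap.ker (d A G i (i + 1) rfl))

end GraphCohomology

/-!
The upper bound on the degrees is proved by deletion and contraction, carried out inside the cube of
edge sets of the fixed graph `G`. For `B ⊆ U ⊆ E(G)` let the complex on the interval `[B, U]` be the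
one formed by the modules `C^s(G)` with `B ⊆ s ⊆ U`. It is the complex of the graph `[G : U]` with the
edges in `B` contracted, so no contracted graphs have to be constructed. Deleting an edge `e`
replaces `U` by `U \ {e}`, contracting it replaces `B` by `B ∪ {e}`, and the complex of the
contraction is a subcomplex of that of `[B, U]` with the complex of the deletion as quotient. Three
facts about exactness in a given degree follow:

* exactness of the deletion and the contraction implies exactness
  (`CubeDiagram.isExact_of_deletion_contraction`);
* if `e` is a loop, the connecting map is an isomorphism and the complex is exact in all degrees
  (`isExact_of_loop`);
* if `e` is a leaf edge, the connecting map has a section, `a ↦ a ⊗ 1`, so exactness of the deletion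
  alone suffices (`isExact_of_leaf`).

By the last fact, the cohomology of a forest is concentrated in degree zero (`IsForest.isExact`).
In general, let `M` be the set of vertices of the components of `G` that are not trees. As long as
there is an edge of the contracted graph on a cycle and there is no loop, that edge is deleted and
contracted. Both steps leave the components of `[G : U]` as they are, and a contraction lowers the
number of vertices in `M` by one while shifting the degree by one, so the bound "vertices in `M` minus
twice the components in `M`" is preserved. The process ends with a loop, where all cohomology
vanishes, or with a forest. In the second case each component in `M` still has an edge, hence two
vertices, so the bound is nonnegative and the forest satisfies it. This is
`isExact_of_compCount_lt`. That `M` contains every edge that is not a bridge comes from closing a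
path to a cycle (`exists_cycle`).

The lower bounds are immediate: there are no cochains in negative degrees, and the cohomology in
degree zero is a subgroup of a tensor power of the free group `A`, hence torsion-free
(`torsion_cohomology_zero`).
-/

namespace GraphCohomology

/-! ### Cochains on intervals of the cube of edge sets -/

/-- A diagram of abelian groups indexed by the finite subsets of `β`, ordered by inclusion. -/
structure CubeDiagram (β : Type v) where
  /-- the group at a vertex of the cube -/
  obj : Finset β → Type w
  [grp : ∀ s, AddCommGroup (obj s)]
  /-- the transition maps -/
  map : ∀ {s t : Finset β}, s ⊆ t → obj s →+ obj t
  map_map : ∀ {s t r : Finset β} (h : s ⊆ t) (h' : t ⊆ r) (x : obj s),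
    map h' (map h x) = map (h.trans h') x

attribute [instance] CubeDiagram.grp

/-- The sign attached to the edge of the cube from `t \ {e}` to `t`. -/
def cubeSign {β : Type v} [LinearOrder β] (t : Finset β) (e : β) : ℤ :=
  (-1) ^ ((t.erase e).filter (fun e' => e' < e)).card

theorem cubeSign_mul_self {β : Type v} [LinearOrder β] (t : Finset β) (e : β) :
    cubeSign t e * cubeSign t e = 1 := by
  rw [cubeSign, ← mul_pow]; simp

theorem cubeSign_swap {β : Type v} [LinearOrder β] {r : Finset β} {e f : β} (he : e ∈ r)
    (hf : f ∈ r) (hef : e ≠ f) :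
    cubeSign r e * cubeSign (r.erase e) f = -(cubeSign r f * cubeSign (r.erase f) e) :=
  sign_swap r he hf hef

namespace CubeDiagram

theorem map_congr {β : Type v} {F : CubeDiagram.{v, w} β} {s s' t : Finset β} (h : s = s')
    (hs : s ⊆ t) (hs' : s' ⊆ t) (x : ∀ s, F.obj s) : F.map hs (x s) = F.map hs' (x s') := by
  subst h; rfl

variable {β : Type v} [LinearOrder β] (F : CubeDiagram.{v, w} β)

/-- The value at `t` of the differential of the complex on the sets containing `B`: only elements
outside `B` may be removed. -/
def diff (B : Finset β) (x : ∀ s, F.obj s) (t : Finset β) : F.obj t :=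
  ∑ e ∈ t \ B, cubeSign t e • F.map (t.erase_subset e) (x (t.erase e))

/-- A family of elements is a cocycle of degree `i` on the interval `[B, U]` if its differential
vanishes at the sets with `i + 1` elements. Degrees are counted by the full number of elements
of a set, so that contracting an element does not shift them. -/
def IsCocycle (B U : Finset β) (i : ℕ) (x : ∀ s, F.obj s) : Prop :=
  ∀ t, B ⊆ t → t ⊆ U → t.card = i + 1 → F.diff B x t = 0

/-- The cohomology in degree `i` of the complex on the interval `[B, U]` vanishes. -/
def IsExact (B U : Finset β) (i : ℕ) : Prop :=
  ∀ x, F.IsCocycle B U i x →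
    ∃ y, ∀ s, B ⊆ s → s ⊆ U → s.card = i → x s = F.diff B y s

variable {F}

theorem diff_eq_add {B t : Finset β} {e : β} (he : e ∈ t) (heB : e ∉ B) (x : ∀ s, F.obj s) :
    F.diff B x t = cubeSign t e • F.map (t.erase_subset e) (x (t.erase e)) +
      F.diff (insert e B) x t := by
  rw [diff, diff, ← Finset.add_sum_erase _ _ (Finset.mem_sdiff.2 ⟨he, heB⟩), ← Finset.sdiff_insert]

theorem diff_congr {B t : Finset β} {x y : ∀ s, F.obj s}
    (h : ∀ e ∈ t \ B, x (t.erase e) = y (t.erase e)) : F.diff B x t = F.diff B y t :=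
  Finset.sum_congr rfl fun e he => by rw [h e he]

theorem diff_add (B : Finset β) (x y : ∀ s, F.obj s) (t : Finset β) :
    F.diff B (x + y) t = F.diff B x t + F.diff B y t := by
  simp only [diff, Pi.add_apply, map_add, smul_add, Finset.sum_add_distrib]

theorem subset_erase_of_mem_sdiff {B t : Finset β} {e : β} (hB : B ⊆ t) (he : e ∈ t \ B) :
    B ⊆ t.erase e :=
  Finset.subset_erase.2 ⟨hB, (Finset.mem_sdiff.1 he).2⟩

/-- The differential anticommutes with the signed transition map along a fixed element `e`. -/
theorem diff_insert_signed {B t : Finset β} {e : β} (het : e ∈ t) (x : ∀ s, F.obj s) :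
    F.diff (insert e B) (fun s => cubeSign s e • F.map (s.erase_subset e) (x (s.erase e))) t =
      -(cubeSign t e • F.map (t.erase_subset e) (F.diff B x (t.erase e))) := by
  have hset : t.erase e \ B = t \ insert e B := by
    ext a; simp only [Finset.mem_sdiff, Finset.mem_erase, Finset.mem_insert]; tauto
  rw [diff, diff, hset, map_sum, Finset.smul_sum, ← Finset.sum_neg_distrib]
  refine Finset.sum_congr rfl fun f hf => ?_
  rw [Finset.mem_sdiff, Finset.mem_insert, not_or] at hf
  rw [map_zsmul, map_zsmul, F.map_map, F.map_map, smul_smul, smul_smul, ← neg_smul,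
    cubeSign_swap hf.1 het hf.2.1]
  congr 1
  exact map_congr Finset.erase_right_comm _ _ x

/-- The deletion–contraction step, at the level of elements. If the complex of the deletion
`[B, U \ {e}]` is exact in degree `i`, and every cocycle of the contraction `[B ∪ {e}, U]` is, up to a coboundary,
the image of a cocycle `w` of the deletion under the connecting map, then `[B, U]` is exact in
degree `i`. -/
theorem isExact_of_connecting_surjective {B U : Finset β} {e : β} (heB : e ∉ B)
    {i : ℕ} (hdel : F.IsExact B (U.erase e) i)
    (hcon : ∀ z, F.IsCocycle (insert e B) U i z → ∃ w y,
      (∀ t, B ⊆ t → t ⊆ U.erase e → t.card = i → F.diff B w t = 0) ∧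
      ∀ s, insert e B ⊆ s → s ⊆ U → s.card = i →
        z s = cubeSign s e • F.map (s.erase_subset e) (w (s.erase e)) +
          F.diff (insert e B) y s) :
    F.IsExact B U i := by
  intro x hx
  obtain ⟨y₀, hy₀⟩ := hdel x fun t h1 h2 h3 => hx t h1 (h2.trans (U.erase_subset e)) h3
  -- correct `x` by the coboundary of `y₀` to make it vanish on the sets without `e`
  obtain ⟨w, y₁, hw, hy₁⟩ := hcon
    (x + fun s => -(cubeSign s e • F.map (s.erase_subset e) (y₀ (s.erase e)))) (by
      intro t hBt htU hcard
      have het : e ∈ t := hBt (Finset.mem_insert_self e B)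
      have hBt' : B ⊆ t := (Finset.subset_insert e B).trans hBt
      have hBe : B ⊆ t.erase e := Finset.subset_erase.2 ⟨hBt', heB⟩
      have hneg : (fun s => -(cubeSign s e • F.map (s.erase_subset e) (y₀ (s.erase e)))) =
          fun s => cubeSign s e • F.map (s.erase_subset e) ((-y₀) (s.erase e)) := by
        funext s; simp
      have hdneg : F.diff B (-y₀) (t.erase e) = -F.diff B y₀ (t.erase e) := by
        simp [diff]
      rw [diff_add, hneg, diff_insert_signed het, hdneg,
        ← hy₀ _ hBe (Finset.erase_subset_erase e htU) (by rw [Finset.card_erase_of_mem het]; omega),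
        map_neg, smul_neg, neg_neg, add_comm, ← diff_eq_add het heB]
      exact hx t hBt' htU hcard)
  refine ⟨fun s => if e ∈ s then y₁ s else y₀ s + w s, fun s hBs hsU hcard => ?_⟩
  by_cases hes : e ∈ s
  · have hBs' : insert e B ⊆ s := Finset.insert_subset hes hBs
    have h := hy₁ s hBs' hsU hcard
    rw [diff_eq_add hes heB, if_neg (Finset.notMem_erase e s), map_add, smul_add,
      diff_congr (y := y₁)]
    · rw [Pi.add_apply, add_neg_eq_iff_eq_add] at h
      rw [h]; abel
    · intro f hf
      have hef : e ∈ s.erase f := subset_erase_of_mem_sdiff hBs' hf (Finset.mem_insert_self e B)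
      simp only [if_pos hef]
  · have hsU' : s ⊆ U.erase e := Finset.subset_erase.2 ⟨hsU, hes⟩
    rw [diff_congr (y := y₀ + w), diff_add, hw s hBs hsU' hcard, add_zero]
    · exact hy₀ s hBs hsU' hcard
    · intro f _
      have hef : e ∉ s.erase f := fun h => hes (Finset.mem_of_mem_erase h)
      simp only [if_neg hef, Pi.add_apply]

/-- Exactness of the deletion and of the contraction gives exactness. -/
theorem isExact_of_deletion_contraction {B U : Finset β} {e : β} (heB : e ∉ B)
    {i : ℕ} (hdel : F.IsExact B (U.erase e) i) (hcon : F.IsExact (insert e B) U i) :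
    F.IsExact B U i := by
  refine isExact_of_connecting_surjective heB hdel fun z hz => ?_
  obtain ⟨y, hy⟩ := hcon z hz
  exact ⟨0, y, fun t _ _ _ => by simp [diff], fun s h1 h2 h3 => by simp [hy s h1 h2 h3]⟩

/-- If the transition maps along `e` have sections that are natural on `[B, U]`, the connecting map
is surjective on cocycles, and exactness passes from the deletion of `e` to `[B, U]`. -/
theorem isExact_of_natural_section {B U : Finset β} {e : β} (heU : e ∈ U) (heB : e ∉ B)
    {i : ℕ} (hdel : F.IsExact B (U.erase e) i)
    (σ : ∀ s t : Finset β, B ⊆ s → s ⊆ U.erase e → t ⊆ insert e s → (F.obj t →+ F.obj s))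
    (hσ : ∀ s hB hU x,
      F.map (Finset.subset_insert e s) (σ s (insert e s) hB hU subset_rfl x) = x)
    (hnat : ∀ s t hB hU ht s' t' hB' hU' ht' (hs : s ⊆ s') (htt : t ⊆ t') x,
      F.map hs (σ s t hB hU ht x) = σ s' t' hB' hU' ht' (F.map htt x)) :
    F.IsExact B U i := by
  classical
  refine isExact_of_connecting_surjective heB hdel fun z hz => ?_
  let w : ∀ s, F.obj s := fun s => if h : B ⊆ s ∧ s ⊆ U.erase e then
    σ s (insert e s) h.1 h.2 subset_rfl (cubeSign (insert e s) e • z (insert e s)) else 0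
  refine ⟨w, 0, fun t hBt htU hcard => ?_, fun s hBs hsU hcard => ?_⟩
  · have het : e ∉ t := fun h => Finset.notMem_erase e U (htU h)
    have hzt := hz (insert e t) (Finset.insert_subset_insert e hBt)
      (Finset.insert_subset heU (htU.trans (U.erase_subset e)))
      (by rw [Finset.card_insert_of_notMem het, hcard])
    have key : F.diff B w t = -(cubeSign (insert e t) e •
        σ t (insert e t) hBt htU subset_rfl (F.diff (insert e B) z (insert e t))) := by
      have hset : insert e t \ insert e B = t \ B := by
        ext a; simp only [Finset.mem_sdiff, Finset.mem_insert]
        constructor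
        · tauto
        · rintro ⟨h1, h2⟩
          have : a ≠ e := fun h => het (h ▸ h1)
          tauto
      rw [diff, diff, hset, map_sum, Finset.smul_sum, ← Finset.sum_neg_distrib]
      refine Finset.sum_congr rfl fun f hf => ?_
      have hBf := subset_erase_of_mem_sdiff hBt hf
      rw [Finset.mem_sdiff] at hf
      have hfe : f ≠ e := fun h => het (h ▸ hf.1)
      have hcomm : insert e (t.erase f) = (insert e t).erase f :=
        (Finset.erase_insert_of_ne hfe.symm).symm
      have hsgn : cubeSign t f * cubeSign (insert e (t.erase f)) e =
          -(cubeSign (insert e t) e * cubeSign (insert e t) f) := by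
        have h := cubeSign_swap (Finset.mem_insert_of_mem hf.1) (Finset.mem_insert_self e t) hfe
        rw [Finset.erase_insert het, ← hcomm] at h
        have h1 := cubeSign_mul_self t f
        have h2 := cubeSign_mul_self (insert e t) f
        linear_combination cubeSign t f * cubeSign (insert e t) f * h -
          cubeSign t f * cubeSign (insert e (t.erase f)) e * h2 -
          cubeSign (insert e t) e * cubeSign (insert e t) f * h1
      have hmem : B ⊆ t.erase f ∧ t.erase f ⊆ U.erase e := ⟨hBf, (t.erase_subset f).trans htU⟩
      simp only [w, dif_pos hmem]
      rw [map_zsmul, map_zsmul, smul_smul, hsgn, neg_smul, map_zsmul, smul_smul,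
        hnat _ _ _ _ _ t (insert e t) hBt htU subset_rfl (t.erase_subset f)
          (Finset.insert_subset_insert e (t.erase_subset f))]
      congr 3
      exact map_congr hcomm _ _ z
    rw [key, hzt, map_zero, smul_zero, neg_zero]
  · have hes : e ∈ s := hBs (Finset.mem_insert_self e B)
    have hmem : B ⊆ s.erase e ∧ s.erase e ⊆ U.erase e :=
      ⟨Finset.subset_erase.2 ⟨(Finset.subset_insert e B).trans hBs, heB⟩,
        Finset.erase_subset_erase e hsU⟩
    have h0 : F.diff (insert e B) 0 s = 0 := by simp [diff]
    simp only [w, dif_pos hmem]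
    rw [h0, add_zero, map_zsmul, map_zsmul, smul_smul]
    have hins : insert e (s.erase e) = s := Finset.insert_erase hes
    -- `s` and `insert e (s.erase e)` index different types, hence the generalization
    have gen : ∀ t (ht : t = insert e (s.erase e)) (h : s.erase e ⊆ t),
        cubeSign t e * cubeSign (insert e (s.erase e)) e = 1 ∧
        F.map h (σ (s.erase e) (insert e (s.erase e)) hmem.1 hmem.2 subset_rfl
          (z (insert e (s.erase e)))) = z t := by
      rintro t rfl h
      exact ⟨cubeSign_mul_self _ _, hσ _ _ _ _⟩
    rw [(gen s hins.symm (s.erase_subset e)).1, (gen s hins.symm (s.erase_subset e)).2, one_smul]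

/-- If the transition maps along `e` are isomorphisms on `[B, U]`, the complex is exact in every
degree. -/
theorem isExact_of_bijective {B U : Finset β} {e : β} (heU : e ∈ U) (heB : e ∉ B)
    (hbij : ∀ s t : Finset β, B ⊆ s → ∀ (hs : s ⊆ t), t ⊆ insert e s →
      Function.Bijective (F.map hs)) (i : ℕ) :
    F.IsExact B U i := by
  classical
  intro x hx
  have hsurj : ∀ s, B ⊆ s → ∃ a : F.obj s,
      F.map (Finset.subset_insert e s) a = cubeSign (insert e s) e • x (insert e s) :=
    fun s hs => (hbij s _ hs (Finset.subset_insert e s) subset_rfl).2 _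
  -- a primitive supported on the sets without `e`, obtained by inverting the maps along `e`
  let y : ∀ s, F.obj s := fun s => if h : B ⊆ s ∧ e ∉ s then (hsurj s h.1).choose else 0
  have hy : ∀ s, B ⊆ s → e ∈ s →
      cubeSign s e • F.map (s.erase_subset e) (y (s.erase e)) = x s := by
    intro s hBs hes
    have hmem : B ⊆ s.erase e ∧ e ∉ s.erase e :=
      ⟨Finset.subset_erase.2 ⟨hBs, heB⟩, Finset.notMem_erase e s⟩
    have hins : insert e (s.erase e) = s := Finset.insert_erase hes
    simp only [y, dif_pos hmem]
    have hspec := (hsurj _ hmem.1).choose_spec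
    generalize (hsurj _ hmem.1).choose = a at hspec ⊢
    have gen : ∀ t (ht : t = insert e (s.erase e)) (h : s.erase e ⊆ t),
        cubeSign t e • F.map h a = x t := by
      rintro t rfl h
      rw [hspec, smul_smul, cubeSign_mul_self, one_smul]
    exact gen s hins.symm _
  have hdy : ∀ s, B ⊆ s → e ∈ s → F.diff B y s = x s := by
    intro s hBs hes
    rw [diff_eq_add hes heB, hy s hBs hes, add_eq_left]
    refine Finset.sum_eq_zero fun f hf => ?_
    rw [Finset.mem_sdiff, Finset.mem_insert, not_or] at hf
    have : ¬ (B ⊆ s.erase f ∧ e ∉ s.erase f) :=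
      fun h => h.2 (Finset.mem_erase.2 ⟨Ne.symm hf.2.1, hes⟩)
    simp only [y, dif_neg this, map_zero, smul_zero]
  refine ⟨y, fun s hBs hsU hcard => ?_⟩
  by_cases hes : e ∈ s
  · exact (hdy s hBs hes).symm
  · -- The cocycle condition at `s ∪ {e}` compares `x s` with the differential of `y`.
    have hmem : e ∈ insert e s := Finset.mem_insert_self e s
    have hBi : B ⊆ insert e s := hBs.trans (Finset.subset_insert e s)
    have h0 := hx (insert e s) hBi (Finset.insert_subset heU hsU)
      (by rw [Finset.card_insert_of_notMem hes, hcard])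
    have h1 : F.diff (insert e B) x (insert e s) = F.diff (insert e B)
        (fun s => cubeSign s e • F.map (s.erase_subset e) (y (s.erase e))) (insert e s) := by
      refine diff_congr fun f hf => ?_
      have hfB := (Finset.mem_sdiff.1 hf).2
      exact (hy _ (Finset.subset_erase.2 ⟨hBi, fun h => hfB (Finset.mem_insert_of_mem h)⟩)
        (Finset.mem_erase.2 ⟨fun h => hfB (h ▸ Finset.mem_insert_self _ _), hmem⟩)).symm
    rw [diff_eq_add hmem heB, h1, diff_insert_signed hmem, ← smul_neg, ← smul_add, ← map_neg,
      ← map_add] at h0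
    have h2 := congrArg (fun a => cubeSign (insert e s) e • a) h0
    simp only [smul_smul, cubeSign_mul_self, one_smul, smul_zero] at h2
    have gen : ∀ t (ht : t = s) (h : t ⊆ insert e s), F.map h (x t + -F.diff B y t) = 0 →
        x s = F.diff B y s := by
      rintro t rfl h h3
      have := (hbij t _ hBs h subset_rfl).1 (h3.trans (map_zero _).symm)
      rwa [← sub_eq_add_neg, sub_eq_zero] at this
    exact gen _ (Finset.erase_insert hes) _ h2

end CubeDiagram

/-! ### Connectivity in spanning subgraphs -/

section Conn

variable {α : Type u} {β : Type v} (G : Graph α β)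

/-- The component of a vertex in the spanning subgraph `[G : s]`. -/
def comp (s : Finset β) (x : V(G)) : Component (G.restrict (s : Set β)) :=
  Component.of (G.restrict (s : Set β)) x

variable {G}

theorem comp_surjective (s : Finset β) : Function.Surjective (comp G s) :=
  fun c => Quot.exists_rep c

theorem comp_eq_of_isLink {s : Finset β} {e : β} (he : e ∈ s) {x y : V(G)}
    (h : G.IsLink e x y) : comp G s x = comp G s y :=
  Quot.sound ⟨e, by rw [Graph.restrict_isLink]; exact ⟨he, h⟩⟩

/-- A function of the vertices that is constant along the edges in `s` descends to the components of
`[G : s]`. -/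
def compLift {γ : Sort*} {s : Finset β} (f : V(G) → γ)
    (hf : ∀ e ∈ s, ∀ x y : V(G), G.IsLink e x y → f x = f y) :
    Component (G.restrict (s : Set β)) → γ :=
  Quot.lift f (fun x y ⟨e, he⟩ => by
    rw [Graph.restrict_isLink] at he
    exact hf e he.1 x y he.2)

theorem eq_of_comp_eq {γ : Sort*} {s : Finset β} (f : V(G) → γ)
    (hf : ∀ e ∈ s, ∀ x y : V(G), G.IsLink e x y → f x = f y) {x y : V(G)}
    (h : comp G s x = comp G s y) : f x = f y :=
  congrArg (compLift f hf) h

theorem comp_eq_mono {s t : Finset β} (h : s ⊆ t) {x y : V(G)} (hxy : comp G s x = comp G s y) :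
    comp G t x = comp G t y :=
  congrArg (Component.map (G.restrict_mono_right (Finset.coe_subset.2 h))) hxy

theorem isLink_ends {e : β} {x y a b : V(G)} (h : G.IsLink e x y) (h' : G.IsLink e a b) :
    (a = x ∧ b = y) ∨ (a = y ∧ b = x) := by
  rcases h'.eq_and_eq_or_eq_and_eq h with ⟨h1, h2⟩ | ⟨h1, h2⟩
  · exact Or.inl ⟨Subtype.ext h1, Subtype.ext h2⟩
  · exact Or.inr ⟨Subtype.ext h1, Subtype.ext h2⟩

variable [DecidableEq β]

/-- A path that uses the edge `e` reaches an end of `e` before. -/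
theorem comp_eq_or_of_insert {s : Finset β} {e : β} {x y z w : V(G)} (he : G.IsLink e x y)
    (h : comp G (insert e s) w = comp G (insert e s) z) :
    comp G s w = comp G s z ∨ comp G s w = comp G s x ∨ comp G s w = comp G s y := by
  refine (eq_of_comp_eq (s := insert e s)
    (fun z => comp G s w = comp G s z ∨ comp G s w = comp G s x ∨ comp G s w = comp G s y)
    (fun f hf a b hab => ?_) h).mp (Or.inl rfl)
  rcases Finset.mem_insert.1 hf with rfl | hf
  · rcases isLink_ends he hab with ⟨rfl, rfl⟩ | ⟨rfl, rfl⟩ <;> exact propext (by tauto)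
  · rw [comp_eq_of_isLink hf hab]

theorem comp_eq_or_of_erase {s : Finset β} {e : β} (hes : e ∈ s) {x y z w : V(G)}
    (he : G.IsLink e x y) (h : comp G s w = comp G s z) :
    comp G (s.erase e) w = comp G (s.erase e) z ∨ comp G (s.erase e) w = comp G (s.erase e) x ∨
      comp G (s.erase e) w = comp G (s.erase e) y := by
  refine comp_eq_or_of_insert he ?_
  rwa [Finset.insert_erase hes]

/-- If the ends of a nonbridge `e` are separated by `B`, another edge outside `B` meets their
component. -/
theorem exists_isLink_of_comp_ne {B s : Finset β} {x y : V(G)}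
    (hs : comp G s x = comp G s y) (hB : comp G B x ≠ comp G B y) :
    ∃ f ∈ s, f ∉ B ∧ ∃ a b : V(G), G.IsLink f a b ∧ comp G s x = comp G s a := by
  by_contra! hcon
  -- otherwise the `B`-component of `x` is closed under the edges in `s`
  refine hB ((eq_of_comp_eq (s := s) (fun z => comp G s x = comp G s z ∧ comp G B x = comp G B z)
    (fun f hf a b hab => ?_) hs).mp ⟨rfl, rfl⟩).2
  have h1 := comp_eq_of_isLink hf hab
  by_cases hfB : f ∈ B
  · rw [h1, comp_eq_of_isLink hfB hab]
  · have h2 := hcon f hf hfB a b hab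
    have h3 := h1 ▸ h2
    exact propext ⟨fun h => absurd h.1 h2, fun h => absurd h.1 h3⟩

/-- All the edges in `U \ B` are bridges of `[G : U]`, which says that contracting the edges in `B`
turns `[G : U]` into a forest. -/
def IsForest (G : Graph α β) (B U : Finset β) : Prop :=
  ∀ e ∈ U \ B, ∀ x y : V(G), G.IsLink e x y → comp G (U.erase e) x ≠ comp G (U.erase e) y

/-- A forest with at least one edge has a leaf edge: one with an end `y` whose `B`-component meets
no other edge in `U \ B`. -/
theorem IsForest.exists_leaf [Finite V(G)] {B U : Finset β} (hBU : B ⊆ U) (hU : ∀ e ∈ U, e ∈ E(G))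
    (hF : IsForest G B U) (hne : (U \ B).Nonempty) :
    ∃ e ∈ U \ B, ∃ x y : V(G), G.IsLink e x y ∧
      ∀ f ∈ U, f ∉ B → f ≠ e → ∀ a b : V(G), G.IsLink f a b → comp G B a ≠ comp G B y := by
  -- take an edge and an end of it such that the side of this end is as small as possible
  let side : β × V(G) → Set V(G) := fun p => {z | comp G (U.erase p.1) z = comp G (U.erase p.1) p.2}
  let S : Set (β × V(G)) := {p | p.1 ∈ U \ B ∧ ∃ x : V(G), G.IsLink p.1 x p.2}
  have hS : S.Nonempty := by
    obtain ⟨e, he⟩ := hne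
    obtain ⟨x, y, hxy⟩ := G.exists_isLink_of_mem_edgeSet (hU e (Finset.mem_sdiff.1 he).1)
    exact ⟨(e, ⟨y, hxy.right_mem⟩), he, ⟨x, hxy.left_mem⟩, hxy⟩
  obtain ⟨⟨e, y⟩, ⟨heU, x, hxy⟩, hmin⟩ := WellFounded.has_min
    (InvImage.wf (fun p => (side p).ncard) Nat.lt_wfRel.wf) S hS
  refine ⟨e, heU, x, y, hxy, fun f hf hfB hfe a b hab hay => ?_⟩
  have hfU : f ∈ U \ B := Finset.mem_sdiff.2 ⟨hf, hfB⟩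
  have heB := Finset.mem_sdiff.1 heU
  have hBe : B ⊆ U.erase e := Finset.subset_erase.2 ⟨hBU, heB.2⟩
  have hBf : B ⊆ U.erase f := Finset.subset_erase.2 ⟨hBU, hfB⟩
  have hby : comp G (U.erase e) b = comp G (U.erase e) y :=
    (comp_eq_of_isLink (Finset.mem_erase.2 ⟨hfe, hf⟩) hab).symm.trans (comp_eq_mono hBe hay)
  have hyb : comp G (U.erase f) y ≠ comp G (U.erase f) b := fun h =>
    hF f hfU a b hab ((comp_eq_mono hBf hay).trans h)
  -- the side of `b` after the removal of `f` is strictly smaller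
  refine hmin (f, b) ⟨hfU, a, hab⟩ (Set.ncard_lt_ncard ⟨fun z hz => ?_, fun h => hyb ?_⟩
    (Set.toFinite _))
  · have hsub : (U.erase f).erase e ⊆ U.erase e :=
      Finset.erase_subset_erase e (U.erase_subset f)
    rcases comp_eq_or_of_erase (Finset.mem_erase.2 ⟨hfe.symm, heB.1⟩) hxy
      (Eq.symm (show comp G (U.erase f) z = comp G (U.erase f) b from hz)) with h | h | h
    · exact (comp_eq_mono hsub h).symm.trans hby
    · exact absurd ((comp_eq_mono hsub h).symm.trans hby) (hF e heU x y hxy)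
    · exact absurd (comp_eq_mono ((U.erase f).erase_subset e) h).symm hyb
  · exact h (show comp G (U.erase e) y = comp G (U.erase e) y from rfl)

end Conn

/-! ### The diagram of tensor powers -/

section Diagram

variable (A : Type w) [CommRing A] {α : Type u} {β : Type v} (G : Graph α β) [Finite V(G)]

/-- The diagram of the modules `C^s(G)` and the maps between them that multiply the factors of the
components which are merged. -/
noncomputable def stateDiagram : CubeDiagram.{v, max u w} β where
  obj s := StateModule A G s
  map h := (perEdgeMap A G h).toAddMonoidHom
  map_map h h' x := perEdgeMap_perEdgeMap A G h h' x

variable {G}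

theorem stateDiagram_map_bijective {s t : Finset β} (hs : s ⊆ t)
    (ht : ∀ e ∈ t, ∀ x y : V(G), G.IsLink e x y → comp G s x = comp G s y) :
    Function.Bijective ((stateDiagram A G).map hs) := by
  let c := Component.map (G.restrict_mono_right (Finset.coe_subset.2 hs))
  let g := compLift (comp G s) ht
  have h1 : g ∘ c = id := by
    funext a; obtain ⟨z, rfl⟩ := comp_surjective s a; rfl
  have h2 : c ∘ g = id := by
    funext a; obtain ⟨z, rfl⟩ := comp_surjective t a; rfl
  refine Function.bijective_iff_has_inverse.2 ⟨mulMap A g, fun a => ?_, fun a => ?_⟩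
  · exact (mulMap_mulMap A c g a).trans (by rw [h1, mulMap_id]; rfl)
  · exact (mulMap_mulMap A g c a).trans (by rw [h2, mulMap_id]; rfl)

variable [LinearOrder β]

/-- A loop of the contraction by `B` makes the complex exact. -/
theorem isExact_of_loop {B U : Finset β} {e : β} (heU : e ∈ U) (heB : e ∉ B) {x y : V(G)}
    (he : G.IsLink e x y) (hxy : comp G B x = comp G B y) (i : ℕ) :
    (stateDiagram A G).IsExact B U i := by
  refine CubeDiagram.isExact_of_bijective heU heB (fun s t hBs hst hts => ?_) i
  refine stateDiagram_map_bijective A hst fun f hf a b hab => ?_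
  rcases Finset.mem_insert.1 (hts hf) with rfl | hf
  · rcases isLink_ends he hab with ⟨rfl, rfl⟩ | ⟨rfl, rfl⟩
    · exact comp_eq_mono hBs hxy
    · exact (comp_eq_mono hBs hxy).symm
  · exact comp_eq_of_isLink hf hab

open Classical in
/-- At a leaf edge with leaf `y` and other end `x`, the map that gives the factor of the merged
component to `x` and the unit to `y` is a natural section of the multiplication. -/
theorem isExact_of_leaf {B U : Finset β} {e : β} (heU : e ∈ U) (heB : e ∉ B) {x y : V(G)}
    (he : G.IsLink e x y) (hxy : comp G B x ≠ comp G B y)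
    (hleaf : ∀ f ∈ U, f ∉ B → f ≠ e → ∀ a b : V(G), G.IsLink f a b → comp G B a ≠ comp G B y)
    {i : ℕ} (hdel : (stateDiagram A G).IsExact B (U.erase e) i) :
    (stateDiagram A G).IsExact B U i := by
  let r : V(G) → V(G) := fun z => if comp G B z = comp G B y then x else z
  have hr : ∀ s t : Finset β, B ⊆ s → s ⊆ U.erase e → t ⊆ insert e s →
      ∀ f ∈ t, ∀ a b : V(G), G.IsLink f a b → comp G s (r a) = comp G s (r b) := by
    intro s t hBs hsU hts f hf a b hab
    have hrx : r x = x := if_neg hxy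
    have hry : r y = x := if_pos rfl
    rcases Finset.mem_insert.1 (hts hf) with rfl | hfs
    · rcases isLink_ends he hab with ⟨rfl, rfl⟩ | ⟨rfl, rfl⟩ <;> rw [hrx, hry]
    · by_cases hfB : f ∈ B
      · have h := comp_eq_of_isLink hfB hab
        simp only [r, h]
        split_ifs
        · rfl
        · exact comp_eq_mono hBs h
      · have hfU := Finset.mem_erase.1 (hsU hfs)
        have ha := hleaf f hfU.2 hfB hfU.1 a b hab
        have hb := hleaf f hfU.2 hfB hfU.1 b a hab.symm
        simp only [r, if_neg ha, if_neg hb]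
        exact comp_eq_of_isLink hfs hab
  refine CubeDiagram.isExact_of_natural_section heU heB hdel
    (fun s t hB hU ht => (mulMap A (compLift (fun z => comp G s (r z))
      (hr s t hB hU ht))).toAddMonoidHom) ?_ ?_
  · intro s hB hU a
    refine (mulMap_mulMap A _ _ a).trans ?_
    have h : Component.map (G.restrict_mono_right (Finset.coe_subset.2 (Finset.subset_insert e s))) ∘
        compLift (fun z => comp G s (r z)) (hr s (insert e s) hB hU subset_rfl) = id := by
      funext c
      obtain ⟨z, rfl⟩ := comp_surjective _ c
      change comp G (insert e s) (r z) = comp G (insert e s) z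
      by_cases hz : comp G B z = comp G B y
      · simp only [r, if_pos hz]
        exact (comp_eq_of_isLink (Finset.mem_insert_self e s) he).trans
          (comp_eq_mono (hB.trans (Finset.subset_insert e s)) hz).symm
      · simp only [r, if_neg hz]
    rw [h, mulMap_id]
    rfl
  · intro s t hB hU ht s' t' hB' hU' ht' hs htt a
    refine (mulMap_mulMap A _ _ a).trans (Eq.trans ?_ (mulMap_mulMap A _ _ a).symm)
    congr 2
    funext c
    obtain ⟨z, rfl⟩ := comp_surjective _ c
    rfl

/-- The cohomology of a forest is concentrated in degree zero, here the degree of the set `B`. -/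
theorem IsForest.isExact {B U : Finset β} (hBU : B ⊆ U) (hU : ∀ e ∈ U, e ∈ E(G))
    (hF : IsForest G B U) {i : ℕ} (hi : B.card < i) : (stateDiagram A G).IsExact B U i := by
  induction hn : (U \ B).card generalizing U with
  | zero =>
    have hUB : U ⊆ B := by simpa [Finset.sdiff_eq_empty_iff_subset] using hn
    intro x _
    exact ⟨0, fun s hBs hsU hcard => absurd (Finset.card_le_card (hsU.trans hUB)) (by omega)⟩
  | succ n ih =>
    obtain ⟨e, he, x, y, hxy, hleaf⟩ := hF.exists_leaf hBU hU (Finset.card_pos.1 (by omega))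
    obtain ⟨heU, heB⟩ := Finset.mem_sdiff.1 he
    have hBe : B ⊆ U.erase e := Finset.subset_erase.2 ⟨hBU, heB⟩
    refine isExact_of_leaf A heU heB hxy (fun h => hF e he x y hxy (comp_eq_mono hBe h)) hleaf
      (ih hBe (fun f hf => hU f (Finset.mem_of_mem_erase hf)) (fun f hf a b hab h => ?_) ?_)
    · obtain ⟨hf1, hf2⟩ := Finset.mem_sdiff.1 hf
      exact hF f (Finset.mem_sdiff.2 ⟨Finset.mem_of_mem_erase hf1, hf2⟩) a b hab
        (comp_eq_mono (Finset.erase_subset_erase f (U.erase_subset e)) h)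
    · rw [Finset.erase_sdiff_comm, Finset.card_erase_of_mem he, hn, Nat.add_sub_cancel]

end Diagram

/-! ### The vanishing range by deletion and contraction -/

section Vanishing

variable {α : Type u} {β : Type v} {G : Graph α β} [Finite V(G)]

/-- The number of components of `[G : s]` that meet the vertex set `M`. -/
noncomputable def compCount (M : Set V(G)) (s : Finset β) : ℕ := (comp G s '' M).ncard

theorem compCount_anti (M : Set V(G)) {s t : Finset β} (h : s ⊆ t) :
    compCount M t ≤ compCount M s := by
  have himg : comp G t '' M =
      Component.map (G.restrict_mono_right (Finset.coe_subset.2 h)) '' (comp G s '' M) := by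
    rw [Set.image_image]; rfl
  rw [compCount, himg]
  exact Set.ncard_image_le (Set.toFinite _)

theorem compCount_insert_lt [DecidableEq β] {M : Set V(G)} {s : Finset β} {e : β} {x y : V(G)}
    (he : G.IsLink e x y) (hx : x ∈ M) (hy : y ∈ M) (hxy : comp G s x ≠ comp G s y) :
    compCount M (insert e s) < compCount M s := by
  -- every component of `[G : s ∪ {e}]` that meets `M` is the image of one other than that of `y`
  have hsub : comp G (insert e s) '' M ⊆
      Component.map (G.restrict_mono_right (Finset.coe_subset.2 (Finset.subset_insert e s))) ''
        (comp G s '' M \ {comp G s y}) := by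
    rintro _ ⟨z, hz, rfl⟩
    by_cases hzy : comp G s z = comp G s y
    · refine ⟨comp G s x, ⟨⟨x, hx, rfl⟩, hxy⟩, ?_⟩
      exact (comp_eq_of_isLink (Finset.mem_insert_self e s) he).trans
        (comp_eq_mono (Finset.subset_insert e s) hzy).symm
    · exact ⟨comp G s z, ⟨⟨z, hz, rfl⟩, hzy⟩, rfl⟩
  exact ((Set.ncard_le_ncard hsub (Set.toFinite _)).trans
    (Set.ncard_image_le (Set.toFinite _))).trans_lt
    (Set.ncard_sdiff_singleton_lt_of_mem (Set.mem_image_of_mem _ hy) (Set.toFinite _))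

/-- If every component of `[G : U]` that meets `M` contains an edge in `M` whose ends are separated
by `B`, it splits into at least two components of `[G : B]` that meet `M`. -/
theorem two_mul_compCount_le {M : Set V(G)} {B U : Finset β} (hBU : B ⊆ U)
    (h : ∀ z ∈ M, ∃ a ∈ M, ∃ b ∈ M, comp G U z = comp G U a ∧ comp G U z = comp G U b ∧
      comp G B a ≠ comp G B b) :
    2 * compCount M U ≤ compCount M B := by
  choose! a ha b hb hza hzb hab using h
  have hrep : ∀ c : comp G U '' M, ∃ z ∈ M, comp G U z = c := fun c => c.2
  choose z hz hzc using hrep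
  let f : (comp G U '' M) × Bool → comp G B '' M := fun p =>
    if p.2 then ⟨comp G B (a (z p.1)), Set.mem_image_of_mem _ (ha _ (hz _))⟩
    else ⟨comp G B (b (z p.1)), Set.mem_image_of_mem _ (hb _ (hz _))⟩
  let g : comp G B '' M → Component (G.restrict (U : Set β)) := fun c =>
    Component.map (G.restrict_mono_right (Finset.coe_subset.2 hBU)) c.1
  have hgf : ∀ p, g (f p) = p.1.1 := by
    rintro ⟨c, _ | _⟩
    · exact (hzb _ (hz c)).symm.trans (hzc c)
    · exact (hza _ (hz c)).symm.trans (hzc c)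
  have hf : Function.Injective f := by
    rintro ⟨c, i⟩ ⟨c', j⟩ hcc
    have hc : c = c' := Subtype.ext ((hgf _).symm.trans ((congrArg g hcc).trans (hgf _)))
    subst hc
    have hne := hab _ (hz c)
    cases i <;> cases j
    · rfl
    · exact absurd (congrArg Subtype.val hcc).symm hne
    · exact absurd (congrArg Subtype.val hcc) hne
    · rfl
  have hcard := Nat.card_le_card_of_injective f hf
  rw [Nat.card_prod, Nat.card_eq_fintype_card (α := Bool), Fintype.card_bool,
    Nat.card_coe_set_eq, Nat.card_coe_set_eq] at hcard
  rw [compCount, compCount]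
  omega

end Vanishing

section Induction

variable (A : Type w) [CommRing A] {α : Type u} {β : Type v} [LinearOrder β] {G : Graph α β}
  [Finite V(G)]

/-- Vanishing for the contraction by `B` of `[G : U]`, relative to a union `M` of components of `G`
that contains all the edges of `U \ B` on cycles and each of whose vertices is connected to an edge
in `U \ B`. The contracted graph has `compCount M B` vertices and `compCount M U` components in `M`,
and `compCount M B - 2 * compCount M U` bounds the degrees, counted from `B.card`, in which its
cohomology does not vanish. The condition on the vertices survives deletion and contraction of an
edge on a cycle because the rest of the cycle remains. -/
theorem isExact_of_compCount_lt {M : Set V(G)}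
    (hM : ∀ (e : β) (x y : V(G)), G.IsLink e x y → x ∈ M → y ∈ M)
    {B U : Finset β} (hBU : B ⊆ U) (hU : ∀ e ∈ U, e ∈ E(G))
    (hedge : ∀ z ∈ M, ∃ f ∈ U \ B, ∃ a b : V(G), G.IsLink f a b ∧ comp G U z = comp G U a)
    (hcycle : ∀ e ∈ U \ B, ∀ x y : V(G), G.IsLink e x y →
      comp G (U.erase e) x = comp G (U.erase e) y → x ∈ M)
    {i : ℕ} (hi : compCount M B + B.card < i + 2 * compCount M U) :
    (stateDiagram A G).IsExact B U i := by
  induction hn : (U \ B).card generalizing B U with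
  | zero =>
    refine IsForest.isExact A hBU hU (fun e he => ?_) ?_
    · rw [Finset.card_eq_zero.1 hn] at he
      exact absurd he (Finset.notMem_empty e)
    · have hempty : M = ∅ := by
        refine Set.eq_empty_of_forall_notMem fun z hz => ?_
        obtain ⟨f, hf, -⟩ := hedge z hz
        rw [Finset.card_eq_zero.1 hn] at hf
        exact Finset.notMem_empty f hf
      simp [hempty, compCount] at hi
      exact hi
  | succ n ih =>
    by_cases hloop : ∃ e ∈ U \ B, ∃ x y : V(G), G.IsLink e x y ∧ comp G B x = comp G B y
    · obtain ⟨e, he, x, y, hxy, hB⟩ := hloop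
      obtain ⟨heU, heB⟩ := Finset.mem_sdiff.1 he
      exact isExact_of_loop A heU heB hxy hB i
    push Not at hloop
    by_cases hforest : IsForest G B U
    · refine hforest.isExact A hBU hU ?_
      have h2 : 2 * compCount M U ≤ compCount M B := by
        refine two_mul_compCount_le hBU fun z hz => ?_
        obtain ⟨f, hf, a, b, hab, hza⟩ := hedge z hz
        have hfU := (Finset.mem_sdiff.1 hf).1
        have haM : a ∈ M := (eq_of_comp_eq (s := U) (· ∈ M) (fun e _ x y hxy =>
          propext ⟨hM e x y hxy, hM e y x hxy.symm⟩) hza).mp hz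
        exact ⟨a, haM, b, hM f a b hab haM, hza, hza.trans (comp_eq_of_isLink hfU hab),
          hloop f hf a b hab⟩
      omega
    · -- delete and contract an edge `e` which lies on a cycle
      unfold IsForest at hforest
      push Not at hforest
      obtain ⟨e, he, x, y, hxy, hcyc⟩ := hforest
      obtain ⟨heU, heB⟩ := Finset.mem_sdiff.1 he
      have hBe : B ⊆ U.erase e := Finset.subset_erase.2 ⟨hBU, heB⟩
      have hsub := U.erase_subset e
      have hxM := hcycle e he x y hxy hcyc
      have hyM := hM e x y hxy hxM
      -- the ends of `e` remain joined, so deletion does not change the components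
      have hconn : ∀ {z w : V(G)}, comp G U z = comp G U w →
          comp G (U.erase e) z = comp G (U.erase e) w := by
        intro z w hzw
        have hz := comp_eq_or_of_erase heU hxy hzw
        have hw := comp_eq_or_of_erase heU hxy hzw.symm
        rw [← hcyc, or_self] at hz hw
        rcases hz with hz | hz
        · exact hz
        rcases hw with hw | hw
        · exact hw.symm
        · exact hz.trans hw.symm
      -- every vertex in `M` is joined to an edge other than `e`
      have hedge' : ∀ z ∈ M, ∃ f ∈ U \ B, f ≠ e ∧ ∃ a b : V(G), G.IsLink f a b ∧
          comp G (U.erase e) z = comp G (U.erase e) a := by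
        intro z hz
        obtain ⟨f, hf, a, b, hab, hza⟩ := hedge z hz
        by_cases hfe : f = e
        · subst hfe
          obtain ⟨f', hf', hf'B, a', b', hab', hxa'⟩ :=
            exists_isLink_of_comp_ne hcyc (hloop f he x y hxy)
          obtain ⟨hne, hf'U⟩ := Finset.mem_erase.1 hf'
          refine ⟨f', Finset.mem_sdiff.2 ⟨hf'U, hf'B⟩, hne, a', b', hab',
            (hconn hza).trans (Eq.trans ?_ hxa')⟩
          rcases isLink_ends hxy hab with ⟨rfl, rfl⟩ | ⟨rfl, rfl⟩
          · rfl
          · exact hcyc.symm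
        · exact ⟨f, hf, hfe, a, b, hab, hconn hza⟩
      refine CubeDiagram.isExact_of_deletion_contraction heB (ih hBe
        (fun f hf => hU f (hsub hf)) ?_ ?_ ?_ ?_) (ih (Finset.insert_subset heU hBU) hU ?_ ?_ ?_ ?_)
      · intro z hz
        obtain ⟨f, hf, hfe, a, b, hab, hza⟩ := hedge' z hz
        obtain ⟨hfU, hfB⟩ := Finset.mem_sdiff.1 hf
        exact ⟨f, Finset.mem_sdiff.2 ⟨Finset.mem_erase.2 ⟨hfe, hfU⟩, hfB⟩, a, b, hab, hza⟩
      · intro f hf a b hab h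
        obtain ⟨hfU, hfB⟩ := Finset.mem_sdiff.1 hf
        exact hcycle f (Finset.mem_sdiff.2 ⟨hsub hfU, hfB⟩) a b hab
          (comp_eq_mono (Finset.erase_subset_erase f hsub) h)
      · have := compCount_anti M hsub
        omega
      · rw [Finset.erase_sdiff_comm, Finset.card_erase_of_mem he, hn, Nat.add_sub_cancel]
      · intro z hz
        obtain ⟨f, hf, hfe, a, b, hab, hza⟩ := hedge' z hz
        obtain ⟨hfU, hfB⟩ := Finset.mem_sdiff.1 hf
        refine ⟨f, Finset.mem_sdiff.2 ⟨hfU, ?_⟩, a, b, hab, comp_eq_mono hsub hza⟩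
        exact fun h => (Finset.mem_insert.1 h).elim hfe hfB
      · intro f hf a b hab h
        obtain ⟨hfU, hfB⟩ := Finset.mem_sdiff.1 hf
        exact hcycle f (Finset.mem_sdiff.2
          ⟨hfU, fun h => hfB (Finset.mem_insert_of_mem h)⟩) a b hab h
      · have := compCount_insert_lt hxy hxM hyM (hloop e he x y hxy)
        rw [Finset.card_insert_of_notMem heB]
        omega
      · rw [Finset.sdiff_insert, Finset.card_erase_of_mem he, hn, Nat.add_sub_cancel]

end Induction

/-! ### Cycles through an edge that is not a bridge -/

section Cycle

variable {α : Type u} {β : Type v} {G : Graph α β}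

/-- The simple graph on the vertices of `G` in which two different vertices are adjacent if they are
joined by an edge in `s`. -/
def simpleSpan (G : Graph α β) (s : Finset β) : SimpleGraph V(G) where
  Adj x y := x ≠ y ∧ ∃ e ∈ s, G.IsLink e x y
  symm := ⟨fun _ _ h => ⟨h.1.symm, h.2.imp fun _ he => ⟨he.1, he.2.symm⟩⟩⟩
  loopless := ⟨fun _ h => h.1 rfl⟩

theorem reachable_simpleSpan_iff {s : Finset β} {x y : V(G)} :
    (simpleSpan G s).Reachable x y ↔ comp G s x = comp G s y := by
  refine ⟨?_, fun h => ?_⟩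
  · rintro ⟨p⟩
    induction p with
    | nil => rfl
    | cons hadj _ ih =>
      obtain ⟨_, e, he, hl⟩ := hadj
      exact (comp_eq_of_isLink he hl).trans ih
  · refine (eq_of_comp_eq (s := s) (fun z => (simpleSpan G s).Reachable x z)
      (fun e he a b hab => propext ?_) h).mp (SimpleGraph.Reachable.refl x)
    by_cases hne : a = b
    · rw [hne]
    · have hadj : (simpleSpan G s).Adj a b := ⟨hne, e, he, hab⟩
      exact ⟨fun h => h.trans hadj.reachable, fun h => h.trans hadj.symm.reachable⟩

/-- An edge whose ends are joined by other edges closes a cycle, which stays in the component of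
the ends. -/
theorem exists_cycle {s : Finset β} {e : β} (hes : e ∉ s) {x y : V(G)} (he : G.IsLink e x y)
    (h : comp G s x = comp G s y) :
    ∃ (n : ℕ) (c : Fin (n + 1) → V(G)) (f : Fin (n + 1) → β),
      Function.Injective c ∧ Function.Injective f ∧ (∀ k, G.IsLink (f k) (c k) (c (k + 1))) ∧
        ∀ k, comp G s x = comp G s (c k) := by
  classical
  obtain ⟨p, hp⟩ := (reachable_simpleSpan_iff.2 h).exists_isPath
  have hlink : ∀ k, k < p.length → ∃ f ∈ s, G.IsLink f (p.getVert k) (p.getVert (k + 1)) :=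
    fun k hk => (p.adj_getVert_succ hk).2
  have : Nonempty β := ⟨e⟩
  choose! f hfs hf using hlink
  have hinj : ∀ {a b : ℕ}, a ≤ p.length → b ≤ p.length → p.getVert a = p.getVert b → a = b :=
    fun ha hb hab => hp.getVert_injOn ha hb hab
  refine ⟨p.length, fun k => p.getVert k, fun k => if (k : ℕ) < p.length then f k else e,
    fun a b hab => Fin.ext (hinj (by omega) (by omega) hab), fun a b hab => Fin.ext ?_,
    fun k => ?_, fun k => ?_⟩
  · by_cases ha : (a : ℕ) < p.length <;> by_cases hb : (b : ℕ) < p.length <;>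
      simp only [ha, hb, if_true, if_false] at hab
    · have hfb := hf b hb
      rw [← hab] at hfb
      rcases isLink_ends (hf a ha) hfb with ⟨h1, _⟩ | ⟨h1, h2⟩
      · exact (hinj (by omega) (by omega) h1).symm
      · have h3 := hinj (by omega) (by omega) h1
        have h4 := hinj (by omega) (by omega) h2
        omega
    · exact absurd (hab ▸ hfs a ha) hes
    · exact absurd (hab ▸ hfs b hb) hes
    · omega
  · by_cases hk : (k : ℕ) < p.length
    · have hk1 : ((k + 1 : Fin (p.length + 1)) : ℕ) = k + 1 :=
        Fin.val_add_one_of_lt (Fin.lt_def.2 (by simpa using hk))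
      simp only [if_pos hk, hk1]
      exact hf k hk
    · have hkl : k = Fin.last p.length := Fin.ext (by simp; omega)
      subst hkl
      simp only [Fin.val_last, lt_irrefl, if_false, Fin.last_add_one, Fin.val_zero,
        p.getVert_length, p.getVert_zero]
      exact he.symm
  · exact reachable_simpleSpan_iff.1 ⟨p.take k⟩

end Cycle

/-! ### Tree components -/

section Tree

variable {α : Type u} {β : Type v} {G : Graph α β}

theorem comp_eq_iff_of_eq {E : Finset β} (hE : (E : Set β) = E(G)) {x y : V(G)} :
    comp G E x = comp G E y ↔ Component.of G x = Component.of G y := by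
  refine ⟨fun h => eq_of_comp_eq (Component.of G) (fun e _ a b hab => Quot.sound ⟨e, hab⟩) h,
    fun h => congrArg (Quot.lift (comp G E) fun a b ⟨e, hab⟩ => comp_eq_of_isLink ?_ hab) h⟩
  rw [← Finset.mem_coe, hE]
  exact hab.edge_mem

/-- The components of a union `X` of components of `G` are components of `G`: two vertices of `X`
that are connected in `G` are connected inside `X`. -/
theorem componentOf_eq_of_induce {X : Set α} (hXV : X ⊆ V(G))
    (hX : ∀ (e : β) (x y : α), G.IsLink e x y → x ∈ X → y ∈ X) {a b : V(G.induce X)}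
    (h : Component.of G ⟨a.1, hXV a.2⟩ = Component.of G ⟨b.1, hXV b.2⟩) :
    Component.of (G.induce X) a = Component.of (G.induce X) b := by
  let f : V(G) → Prop := fun z =>
    ∃ hz : z.1 ∈ X, Component.of (G.induce X) a = Component.of (G.induce X) ⟨z.1, hz⟩
  have hf : ∀ z w : V(G), G.Adj z w → f z → f w := by
    rintro z w ⟨e, he⟩ ⟨hz, haz⟩
    have hw := hX e z w he hz
    exact ⟨hw, haz.trans (Quot.sound ⟨e, he, hz, hw⟩)⟩
  have hab := congrArg (Quot.lift f fun z w hzw =>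
    propext ⟨hf z w hzw, hf w z hzw.symm⟩) h
  exact ((Eq.mp hab ⟨a.2, rfl⟩ : f ⟨b.1, hXV b.2⟩)).2

theorem componentGraph_card (c : Component G) :
    Nat.card (Component (componentGraph G c)) = 1 := by
  obtain ⟨x, hx⟩ : ∃ x, Component.of G x = c := Quot.exists_rep c
  refine Nat.card_eq_one_iff_unique.2 ⟨⟨fun p q => ?_⟩,
    ⟨Component.of (componentGraph G c) ⟨x.1, x.2, hx⟩⟩⟩
  induction p using Quot.ind with | _ a => ?_
  induction q using Quot.ind with | _ b => ?_
  obtain ⟨ha, hac⟩ := a.2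
  obtain ⟨hb, hbc⟩ := b.2
  refine componentOf_eq_of_induce (fun z hz => hz.1) ?_ (hac.trans hbc.symm)
  rintro e z w hzw ⟨hz, hzc⟩
  exact ⟨hzw.right_mem, (Quot.sound ⟨e, hzw.symm⟩ :
    Component.of G ⟨w, hzw.right_mem⟩ = Component.of G ⟨z, hz⟩).trans hzc⟩

/-- The vertices of the components that are not trees. -/
def nonTreeVerts (G : Graph α β) : Set V(G) :=
  {x | ¬ IsTree (componentGraph G (Component.of G x))}

theorem exists_isLink_of_mem_nonTreeVerts {x : V(G)} (hx : x ∈ nonTreeVerts G) :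
    ∃ (f : β) (a b : V(G)), G.IsLink f a b ∧ Component.of G x = Component.of G a := by
  have h : ¬ IsAcyclic (componentGraph G (Component.of G x)) :=
    fun h => hx ⟨componentGraph_card _, h⟩
  unfold IsAcyclic at h
  push Not at h
  obtain ⟨n, c, f, -, -, h⟩ := h
  obtain ⟨hl, ⟨ha, hac⟩, ⟨hb, -⟩⟩ := h 0
  exact ⟨f 0, ⟨c 0, ha⟩, ⟨c (0 + 1), hb⟩, hl, hac.symm⟩

theorem mem_nonTreeVerts_of_cycle [DecidableEq β] {E : Finset β} (hE : (E : Set β) = E(G)) {e : β}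
    {x y : V(G)} (he : G.IsLink e x y) (h : comp G (E.erase e) x = comp G (E.erase e) y) :
    x ∈ nonTreeVerts G := by
  obtain ⟨n, c, f, hc, hf, hl, hx⟩ := exists_cycle (Finset.notMem_erase e E) he h
  have hmem : ∀ k, Component.of G (c k) = Component.of G x := fun k =>
    (comp_eq_iff_of_eq hE).1 (comp_eq_mono (E.erase_subset e) (hx k).symm)
  exact fun ht => ht.2 n (fun k => (c k).1) f (Subtype.val_injective.comp hc) hf
    fun k => ⟨hl k, ⟨(c k).2, hmem k⟩, ⟨(c (k + 1)).2, hmem (k + 1)⟩⟩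

theorem nonTreeVerts_closed (e : β) (x y : V(G)) (h : G.IsLink e x y) (hx : x ∈ nonTreeVerts G) :
    y ∈ nonTreeVerts G := by
  have hxy : Component.of G x = Component.of G y := Quot.sound ⟨e, h⟩
  rwa [nonTreeVerts, Set.mem_ofPred_eq, ← hxy]

theorem compCount_nonTreeVerts_empty_le [Finite V(G)] :
    compCount (nonTreeVerts G) (∅ : Finset β) ≤ V(nonTreePart G).ncard := by
  refine (Set.ncard_image_le (Set.toFinite _)).trans ?_
  rw [← Set.ncard_image_of_injective _ Subtype.val_injective]
  refine Set.ncard_le_ncard ?_ (Set.Finite.subset (Set.toFinite V(G)) fun x hx => hx.1)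
  rintro _ ⟨x, hx, rfl⟩
  exact ⟨x.2, hx⟩

theorem card_component_nonTreePart_le [Finite V(G)] {E : Finset β} (hE : (E : Set β) = E(G)) :
    Nat.card (Component (nonTreePart G)) ≤ compCount (nonTreeVerts G) E := by
  rw [compCount, ← Nat.card_coe_set_eq]
  have hV : V(nonTreePart G) ⊆ V(G) := fun x hx => hx.1
  choose r hr using fun c : Component (nonTreePart G) => Quot.exists_rep c
  refine Nat.card_le_card_of_injective (fun c => (⟨comp G E ⟨(r c).1, hV (r c).2⟩,
    Set.mem_image_of_mem _ (r c).2.2⟩ : comp G E '' nonTreeVerts G)) fun c c' h => ?_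
  have h' := (comp_eq_iff_of_eq hE).1 (congrArg Subtype.val h)
  rw [← hr c, ← hr c']
  refine componentOf_eq_of_induce hV ?_ h'
  rintro e x y hxy ⟨hx, hxt⟩
  exact ⟨hxy.right_mem, nonTreeVerts_closed e ⟨x, hx⟩ ⟨y, hxy.right_mem⟩ hxy hxt⟩

end Tree

/-! ### The cohomology groups -/

theorem cochain_subsingleton (A : Type w) [CommRing A] {α : Type u} {β : Type v} {G : Graph α β}
    {i : ℤ} (hi : i < 0) : Subsingleton (Cochain A G i) :=
  have : IsEmpty (State G i) := ⟨fun s => by have := s.card_edges; omega⟩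
  inferInstance

theorem free_of_graded (A : Type w) [CommRing A] (𝒜 : ℕ → Submodule ℤ A) [GradedAlgebra 𝒜]
    [∀ j, Module.Free ℤ (𝒜 j)] :
    Module.Free ℤ A :=
  Module.Free.of_equiv (DirectSum.decomposeLinearEquiv 𝒜).symm

section Cohomology

variable (A : Type w) [CommRing A] {α : Type u} {β : Type v} [LinearOrder β] (G : Graph α β)
  [Finite V(G)]

theorem d_apply_eq_diff {i j : ℤ} (h : i + 1 = j) (x : Cochain A G i)
    (y : ∀ s, (stateDiagram A G).obj s) (hy : ∀ s : State G i, y s.edges = x s) (t : State G j) :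
    d A G i j h x t = (stateDiagram A G).diff ∅ y t.edges := by
  rw [d_apply, CubeDiagram.diff, Finset.sdiff_empty]
  refine Eq.trans (Finset.sum_congr rfl fun e _ => ?_) (Finset.sum_coe_sort t.edges (fun e =>
    cubeSign t.edges e • (stateDiagram A G).map (t.edges.erase_subset e) (y (t.edges.erase e))))
  rw [← hy (t.erase h e)]
  rfl

variable {G}

open Classical in
theorem cohomology_subsingleton {E : Finset β} (hE : (E : Set β) = E(G)) {n : ℕ}
    (h : (stateDiagram A G).IsExact ∅ E n) : Subsingleton (Cohomology A G n) := by
  refine Submodule.Quotient.subsingleton_iff.2 (eq_top_iff.2 ?_)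
  rintro ⟨x, hx⟩ -
  suffices hmem : x ∈ LinearMap.range (d A G (n - 1 : ℤ) n (sub_add_cancel (n : ℤ) 1)) from hmem
  let x' : ∀ s, (stateDiagram A G).obj s := fun s =>
    if hs : (s : Set β) ⊆ E(G) ∧ (s.card : ℤ) = n then x ⟨s, hs.1, hs.2⟩ else 0
  have hx' : ∀ s : State G n, x' s.edges = x s := fun s => dif_pos ⟨s.subset, s.card_edges⟩
  obtain ⟨y, hy⟩ := h x' (fun t _ htE hcard => by
    have ht : (t : Set β) ⊆ E(G) := hE ▸ Finset.coe_subset.2 htE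
    let t' : State G (n + 1) := ⟨t, ht, by rw [hcard]; push_cast; rfl⟩
    have h := d_apply_eq_diff A G rfl x x' hx' t'
    rw [LinearMap.mem_ker.1 hx] at h
    exact h.symm)
  refine ⟨fun s => y s.edges, funext fun s => ?_⟩
  rw [d_apply_eq_diff A G _ _ y (fun _ => rfl) s]
  refine Eq.trans (hy s.edges (Finset.empty_subset _) ?_ (by exact_mod_cast s.card_edges)).symm
    (hx' s)
  rw [← Finset.coe_subset, hE]
  exact s.subset

/-- In degree zero the cohomology is a subgroup of a free group. -/
theorem torsion_cohomology_zero [Module.Free ℤ A] :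
    Submodule.torsion ℤ (Cohomology A G 0) = ⊥ := by
  have hfree : ∀ s : Finset β, Module.Free ℤ (StateModule A G s) := fun s =>
    Module.Free.of_basis (Basis.piTensorProduct fun _ => Module.Free.chooseBasis ℤ A)
  have hbot : (LinearMap.range (d A G (0 - 1) 0 (sub_add_cancel 0 1))).submoduleOf
      (LinearMap.ker (d A G 0 (0 + 1) rfl)) = ⊥ := by
    have := cochain_subsingleton A (G := G) (i := 0 - 1) (by norm_num)
    rw [eq_bot_iff]
    rintro ⟨x, hx⟩ hmem
    obtain ⟨y, hy⟩ := hmem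
    rw [Subsingleton.elim y 0, map_zero] at hy
    exact (Submodule.mem_bot ℤ).2 (Subtype.ext hy.symm)
  have htf : Module.IsTorsionFree ℤ (Cochain A G 0) := inferInstance
  have hker : Module.IsTorsionFree ℤ (LinearMap.ker (d A G 0 (0 + 1) rfl)) := inferInstance
  exact Submodule.isTorsionFree_iff_torsion_eq_bot.1
    ((Submodule.quotEquivOfEqBot _ hbot).injective.moduleIsTorsionFree _ (map_smul _))

end Cohomology

section Bound

variable (A : Type w) [CommRing A] {α : Type u} {β : Type v} [LinearOrder β] {G : Graph α β}
  [Finite V(G)] [Finite E(G)]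

theorem degree_bound_of_nontrivial {i : ℤ} (h : Nontrivial (Cohomology A G i)) :
    0 ≤ i ∧ i ≤ (V(nonTreePart G).ncard : ℤ) - 2 * (Nat.card (Component (nonTreePart G)) : ℤ) := by
  have hi : 0 ≤ i := by
    by_contra! hi
    have := cochain_subsingleton A (G := G) hi
    exact not_subsingleton (Cohomology A G i) inferInstance
  refine ⟨hi, ?_⟩
  by_contra! hlt
  obtain ⟨n, rfl⟩ := Int.eq_ofNat_of_zero_le hi
  let E : Finset β := (Set.toFinite E(G)).toFinset
  have hE : (E : Set β) = E(G) := Set.Finite.coe_toFinset _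
  have hmem : ∀ e, e ∈ E ↔ e ∈ E(G) := fun e => Set.Finite.mem_toFinset _
  have hex : (stateDiagram A G).IsExact ∅ E n := by
    refine isExact_of_compCount_lt A nonTreeVerts_closed (Finset.empty_subset E)
      (fun e he => (hmem e).1 he) (fun z hz => ?_)
      (fun e _ x y hxy h => mem_nonTreeVerts_of_cycle hE hxy h) ?_
    · obtain ⟨f, a, b, hab, hza⟩ := exists_isLink_of_mem_nonTreeVerts hz
      exact ⟨f, by simpa [hmem] using hab.edge_mem, a, b, hab, (comp_eq_iff_of_eq hE).2 hza⟩
    · have h1 := compCount_nonTreeVerts_empty_le (G := G)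
      have h2 := card_component_nonTreePart_le hE
      rw [Finset.card_empty]
      omega
  have := cohomology_subsingleton A hE hex
  exact not_subsingleton (Cohomology A G n) this

end Bound

end GraphCohomology

theorem mainTheorem2 {α β A : Type*} [LinearOrder β] (G : Graph α β) [Finite G.vertexSet]
    [Finite G.edgeSet] [CommRing A] (𝒜 : ℕ → Submodule ℤ A) [GradedAlgebra 𝒜]
    [∀ j, Module.Free ℤ (𝒜 j)] [∀ j, Module.Finite ℤ (𝒜 j)] (i : ℤ) :
    (Nontrivial (GraphCohomology.Cohomology A G i) →
      0 ≤ i ∧ i ≤ ((GraphCohomology.nonTreePart G).vertexSet.ncard : ℤ) -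
        2 * (Nat.card (GraphCohomology.Component (GraphCohomology.nonTreePart G)) : ℤ)) ∧
    (Submodule.torsion ℤ (GraphCohomology.Cohomology A G i) ≠ ⊥ →
      1 ≤ i ∧ i ≤ ((GraphCohomology.nonTreePart G).vertexSet.ncard : ℤ) -
        2 * (Nat.card (GraphCohomology.Component (GraphCohomology.nonTreePart G)) : ℤ)) := by
  refine ⟨fun h => GraphCohomology.degree_bound_of_nontrivial A h, fun h => ?_⟩
  have := GraphCohomology.free_of_graded A 𝒜
  obtain ⟨h0, h1⟩ := GraphCohomology.degree_bound_of_nontrivial A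
    ((Submodule.nontrivial_iff ℤ).1 ⟨_, _, h⟩)
  have hi : i ≠ 0 := by
    rintro rfl
    exact h (GraphCohomology.torsion_cohomology_zero A)
  omega
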